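/- Let $n\ge 1$ be an integer and let $r=2n-1$ or $r=2n$. For $\ell\in\mathbb Z$ put $m_\ell=\binom{r+1}{\ell}$, with $m_\ell=0$ for $\ell<0$. For $k=n,n+1,\dots,r$ let $\mathcal M(k)$ be the real $n\times(k+1)$ Toeplitz matrix with entries $$\mathcal M(k)_{i,j}=m_{(r+1-n)+i-j},\qquad 0\le i\le n-1,\ 0\le j\le k,$$ so that the first row is $(m_n,m_{n-1},\dots,m_0,0,\dots,0)$, cut off after $k+1$ entries, if $r=2n-1$, and $(m_{n+1},m_n,\dots,m_0,0,\dots,0)$, likewise cut off, if $r=2n$. Let $\mathcal N$ be the $n\times n$ matrix formed by the first $n$ columns of $\mathcal M(k)$ (it does not depend on $k$), and let $K$ be the kernel of the block-diagonal matrix with diagonal blocks $\mathcal M(n),\mathcal M(n+1),\dots,\mathcal M(r)$, that is, $K=\bigoplus_{k=n}^{r}\ker\mathcal M(k)$. Then: 1. if $r=2n-1$, then $\dim_{\mathbb R}K=\dfrac{n(n+1)}{2}$ and $\det\mathcal N\ne 0$; 2. if $r=2n$, then $\dim_{\mathbb R}K=\dfrac{(n+1)(n+2)}{2}$ and $\det\mathcal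 N\ne 0$. -/

import Mathlib

/-- The `n × c` Toeplitz matrix, with rows `i = 0, …, n - 1` and columns `j = 0, …, c - 1`, whose
entry in position `(i, j)` is the binomial coefficient `C(r + 1, (r + 1 - n) + i - j)`, read as `0`
when the lower index `(r + 1 - n) + i - j` is negative. (It is used only for `n ≤ r + 1`.) -/
def binomToeplitz (n r c : ℕ) : Matrix (Fin n) (Fin c) ℝ :=
  Matrix.of fun i j =>
    if (j : ℕ) ≤ (r + 1 - n) + (i : ℕ) then
      (Nat.choose (r + 1) ((r + 1 - n) + (i : ℕ) - (j : ℕ)) : ℝ)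
    else 0

/-- The `n × (k + 1)` matrix `𝓜(k)`. With `m_ℓ = C(r + 1, ℓ)` its first row is
`m_n, m_{n-1}, …, m_0, 0, …, 0` if `r = 2n - 1`, and `m_{n+1}, m_n, …, m_0, 0, …, 0`
if `r = 2n`. -/
def blockM (n r k : ℕ) : Matrix (Fin n) (Fin (k + 1)) ℝ :=
  binomToeplitz n r (k + 1)

/-- The `n × n` matrix `𝓝`: the first `n` columns of each of the matrices `𝓜(k)`, `n ≤ k ≤ r`. -/
def blockN (n r : ℕ) : Matrix (Fin n) (Fin n) ℝ :=
  binomToeplitz n r n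

/-- The block-diagonal matrix with diagonal blocks `𝓜(n), 𝓜(n + 1), …, 𝓜(r)`. -/
def coeffMatrix (n r : ℕ) :
    Matrix (Σ _k : Finset.Icc n r, Fin n) (Σ k : Finset.Icc n r, Fin ((k : ℕ) + 1)) ℝ :=
  Matrix.blockDiagonal' fun k : Finset.Icc n r => blockM n r (k : ℕ)

/-- The kernel `K` of the block-diagonal matrix, a real vector space. -/
noncomputable def kerK (n r : ℕ) :
    Submodule ℝ ((Σ k : Finset.Icc n r, Fin ((k : ℕ) + 1)) → ℝ) :=
  LinearMap.ker (coeffMatrix n r).mulVecLin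

/-! Put `m = r + 1 - n`. If `𝓝 v = 0` and `V = ∑ v_j X^j`, then `P = (X + 1)^(m + n) * V` has zero
coefficients in degrees `m, …, m + n - 1`. So `P^(m)` is divisible by `X^n` and by `(X + 1)^n`; if
`V ≠ 0`, its degree is below `2n`, forcing `P^(m) = 0`, although `deg P ≥ m + n`. Thus `𝓝` is
invertible, each `𝓜(k)` has rank `n`, and rank-nullity gives `dim K = ∑ (k + 1 - n)`. -/

open Polynomial in
/-- A polynomial `V` of degree less than `n` vanishes if the coefficients of `(X + 1) ^ (m + n) * V`
in the degrees `m, …, m + n - 1` all vanish. -/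
theorem eq_zero_of_coeff_X_add_one_pow_mul_eq_zero {m n : ℕ} {V : ℝ[X]} (hV : V.degree < n)
    (h : ∀ i < n, ((X + 1) ^ (m + n) * V).coeff (i + m) = 0) : V = 0 := by
  by_contra hV0
  have hmonic : ((X : ℝ[X]) + 1).Monic := by simpa using monic_X_add_C (1 : ℝ)
  have hnd : ((X + 1) ^ (m + n) * V).natDegree = m + n + V.natDegree := by
    rw [(hmonic.pow _).natDegree_mul' hV0, hmonic.natDegree_pow]
    have : ((X : ℝ[X]) + 1).natDegree = 1 := by simpa using natDegree_X_add_C (1 : ℝ)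
    rw [this, mul_one]
  have hVn : V.natDegree < n := (natDegree_lt_iff_degree_lt hV0).2 hV
  set P : ℝ[X] := (X + 1) ^ (m + n) * V with hP
  have hP0 : P ≠ 0 := mul_ne_zero (hmonic.pow _).ne_zero hV0
  have h1 : (X + 1) ^ n ∣ derivative^[m] P := by
    have := pow_sub_dvd_iterate_derivative_of_pow_dvd m (hP ▸ dvd_mul_right _ V :
      ((X : ℝ[X]) + 1) ^ (m + n) ∣ P)
    rwa [Nat.add_sub_cancel_left] at this
  have h2 : X ^ n ∣ derivative^[m] P := by
    rw [X_pow_dvd_iff]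
    intro d hd
    rw [coeff_iterate_derivative, h d hd, smul_zero]
  have hcop : IsCoprime ((X : ℝ[X]) ^ n) ((X + 1) ^ n) :=
    IsCoprime.pow ⟨-1, 1, by ring⟩
  have hD : derivative^[m] P = 0 := by
    refine eq_zero_of_dvd_of_natDegree_lt (hcop.mul_dvd h2 h1) ?_
    have hle := natDegree_iterate_derivative P m
    have : ((X : ℝ[X]) ^ n * (X + 1) ^ n).natDegree = n + n := by
      rw [(monic_X_pow n).natDegree_mul (hmonic.pow n), hmonic.natDegree_pow, natDegree_X_pow]
      have : ((X : ℝ[X]) + 1).natDegree = 1 := by simpa using natDegree_X_add_C (1 : ℝ)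
      rw [this, mul_one]
    omega
  -- This coefficient is the leading coefficient of `P` times a nonzero descending factorial.
  have hc := congrArg (fun Q => Q.coeff (n + V.natDegree)) hD
  simp only [coeff_iterate_derivative, coeff_zero] at hc
  rw [show n + V.natDegree + m = P.natDegree by omega, coeff_natDegree, smul_eq_zero] at hc
  rcases hc with hc | hc
  · rw [Nat.descFactorial_eq_zero_iff_lt] at hc
    omega
  · exact hP0 (leadingCoeff_eq_zero.1 hc)

open Polynomial in
theorem det_blockN_ne_zero {n r : ℕ} (hr : n ≤ r + 1) : (blockN n r).det ≠ 0 := by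
  intro hdet
  obtain ⟨v, hv0, hv⟩ := Matrix.exists_mulVec_eq_zero_iff.2 hdet
  have hmn : r + 1 - n + n = r + 1 := Nat.sub_add_cancel hr
  have hV : (∑ j : Fin n, C (v j) * X ^ (j : ℕ) : ℝ[X]) = 0 := by
    refine eq_zero_of_coeff_X_add_one_pow_mul_eq_zero (m := r + 1 - n) (degree_sum_fin_lt v) ?_
    intro i hi
    have hvi := congrFun hv ⟨i, hi⟩
    rw [Pi.zero_apply] at hvi
    rw [← hvi, hmn, Finset.mul_sum, finsetSum_coeff]
    refine Finset.sum_congr rfl fun j _ => ?_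
    rw [mul_left_comm, coeff_C_mul, coeff_mul_X_pow', mul_comm]
    simp only [coeff_X_add_one_pow, blockN, binomToeplitz, Matrix.of_apply, add_comm i]
  refine hv0 (funext fun j => ?_)
  have := congrArg (fun Q => Q.coeff (j : ℕ)) hV
  simpa [finsetSum_coeff, coeff_X_pow, Fin.val_inj] using this

theorem exists_blockM_mul_eq_one {n r k : ℕ} (hr : n ≤ r + 1) (hk : n ≤ k + 1) :
    ∃ R : Matrix (Fin (k + 1)) (Fin n) ℝ, blockM n r k * R = 1 := by
  -- The right inverse is `𝓝⁻¹` with zero rows appended below.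
  refine ⟨(1 : Matrix (Fin (k + 1)) (Fin (k + 1)) ℝ).submatrix id (Fin.castLE hk) *
    (blockN n r)⁻¹, ?_⟩
  have : blockM n r k *
      (1 : Matrix (Fin (k + 1)) (Fin (k + 1)) ℝ).submatrix id (Fin.castLE hk) = blockN n r := by
    ext i j
    simp only [Matrix.mul_apply, Matrix.submatrix_apply, id_eq, Matrix.one_apply, mul_ite, mul_one,
      mul_zero, Finset.sum_ite_eq', Finset.mem_univ, if_true]
    rfl
  rw [← Matrix.mul_assoc, this]
  exact Matrix.mul_nonsing_inv _ (det_blockN_ne_zero hr).isUnit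

theorem coeffMatrix_mulVecLin_surjective {n r : ℕ} (hr : n ≤ r + 1) :
    Function.Surjective (coeffMatrix n r).mulVecLin := by
  choose R hR using fun k : Finset.Icc n r =>
    exists_blockM_mul_eq_one (k := k) hr ((Finset.mem_Icc.1 k.2).1.trans (Nat.le_succ _))
  intro w
  refine ⟨(Matrix.blockDiagonal' R).mulVec w, ?_⟩
  rw [Matrix.mulVecLin_apply, Matrix.mulVec_mulVec, coeffMatrix, ← Matrix.blockDiagonal'_mul]
  simp only [hR]
  rw [show (fun _ : Finset.Icc n r => (1 : Matrix (Fin n) (Fin n) ℝ)) = 1 from rfl,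
    Matrix.blockDiagonal'_one, Matrix.one_mulVec]

theorem finrank_kerK {n r : ℕ} (hr : n ≤ r + 1) :
    Module.finrank ℝ (kerK n r) = (r + 1 - n) * (r + 2 - n) / 2 := by
  have h := LinearMap.finrank_range_add_finrank_ker (coeffMatrix n r).mulVecLin
  rw [LinearMap.range_eq_top.2 (coeffMatrix_mulVecLin_surjective hr), finrank_top,
    Module.finrank_fintype_fun_eq_card, Module.finrank_fintype_fun_eq_card, Fintype.card_sigma,
    Fintype.card_sigma] at h
  simp only [Fintype.card_fin] at h
  rw [Finset.sum_coe_sort (Finset.Icc n r) (fun _ => n),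
    Finset.sum_coe_sort (Finset.Icc n r) (fun k => k + 1)] at h
  obtain ⟨d, hd⟩ := Nat.exists_eq_add_of_le hr
  have hIcc : Finset.Icc n r = Finset.Ico n (n + d) := by
    ext
    simp only [Finset.mem_Icc, Finset.mem_Ico]
    omega
  -- The block `k = n + i` has nullity `i + 1`; the extra term `i = 0` on the right is zero.
  have hsum : ∑ k ∈ Finset.Icc n r, (k + 1) =
      ∑ _k ∈ Finset.Icc n r, n + ∑ i ∈ Finset.range (d + 1), i := by
    rw [hIcc, Finset.sum_Ico_eq_sum_range, Finset.sum_Ico_eq_sum_range, Finset.sum_range_succ',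
      add_zero, Nat.add_sub_cancel_left, ← Finset.sum_add_distrib]
    exact Finset.sum_congr rfl fun _ _ => add_assoc _ _ _
  rw [hsum, add_right_inj, Finset.sum_range_id] at h
  rw [kerK, h, show r + 1 - n = d by omega, show r + 2 - n = d + 1 by omega, Nat.add_sub_cancel,
    mul_comm]

theorem lemma3p2 (n : ℕ) (hn : 1 ≤ n) :
    (Module.finrank ℝ (kerK n (2 * n - 1)) = n * (n + 1) / 2 ∧
      (blockN n (2 * n - 1)).det ≠ 0) ∧
    (Module.finrank ℝ (kerK n (2 * n)) = (n + 1) * (n + 2) / 2 ∧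
      (blockN n (2 * n)).det ≠ 0) := by
  refine ⟨⟨?_, det_blockN_ne_zero (by omega)⟩, ?_, det_blockN_ne_zero (by omega)⟩
  · rw [finrank_kerK (by omega), show 2 * n - 1 + 1 - n = n by omega,
      show 2 * n - 1 + 2 - n = n + 1 by omega]
  · rw [finrank_kerK (by omega), show 2 * n + 1 - n = n + 1 by omega,
      show 2 * n + 2 - n = n + 2 by omega]
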